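/- Let $k$ be a field and $n$ a natural number. Let $h_{(0,1)}(D)$ be the $k$-algebra generated by $x_1,\dots,x_n,\partial_1,\dots,\partial_n,h$, where $\partial_i x_i = x_i\partial_i + h$ for every $i$ and all other pairs of generators commute. Let $h'(D)$ be the $k$-algebra generated by $x_1,\dots,x_n,\partial_1,\dots,\partial_n,h,h'$, where $\partial_i x_i = x_i\partial_i + hh'$ for every $i$ and all other pairs of generators commute. Every element has a unique expansion in the normally ordered monomials $x^\alpha\partial^\beta h^k$, respectively $x^\alpha\partial^\beta h^k h'^l$. For a total order on these monomials, the leading exponent $\exp(P)$ of $P\neq 0$ is the exponent of the largest monomial that occurs in $P$, and $\mathrm{Exp}(I)=\{\exp(P) : 0\ne P\in I\}$ for a left ideal $I$. An element of $h'(D)$ is homogeneous if all its monomials have the same total degree $|\alpha|+|\beta|+k+l$; a left ideal of $h'(D)$ is homogeneous if it can be generated by homogeneous elements. For $P\in h'(D)$ let $P_{|h'=1}\in h_{(0,1)}(D)$ be its image under the algebra homomorphism that sends $h'$ to $1$ and fixes the other generators. Let $\prec_1$ be a total order on the monomials $x^\alpha\partial^\beta h^k$ which is compatible with multiplication (adding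 the same exponent to both sides preserves $\prec_1$) and satisfies: (1) $x_i\partial_i \succ_1 h$ for all $i$; (2) if $|\beta|+k<|\beta'|+k'$ then $x^\alpha\partial^\beta h^k \prec_1 x^{\alpha'}\partial^{\beta'}h^{k'}$; (3) $x^\alpha \preceq_1 1$ for all $\alpha\in\mathbb{N}^n$. Define the order $\prec$ on the monomials of $h'(D)$ by: $x^\alpha\partial^\beta h^k h'^l \prec x^{\alpha'}\partial^{\beta'}h^{k'}h'^{l'}$ if and only if $|\alpha|+|\beta|+k+l<|\alpha'|+|\beta'|+k'+l'$, or these total degrees are equal and $x^\alpha\partial^\beta h^k\prec_1 x^{\alpha'}\partial^{\beta'}h^{k'}$. **Theorem.** Let $J\subset h'(D)$ be a homogeneous left ideal, generated by a set $F$. Let $G$ be a Gröbner basis of $J$ for $\prec$ consisting of homogeneous elements, that is, a finite set of nonzero homogeneous elements of $J$ with $\mathrm{Exp}_\prec(J)=\bigcup_{g\in G}(\exp_\prec(g)+\mathbb{N}^{2n+2})$. Then $G_{|h'=1}=\{g_{|h'=1} : g\in G\}$ is a standard basis, with respect to $\prec_1$, of the left ideal $I$ of $h_{(0,1)}(D)$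 generated by $F_{|h'=1}$; that is, $G_{|h'=1}$ is a finite set of nonzero elements, it generates $I$ as a left ideal, and $\mathrm{Exp}_{\prec_1}(I)=\bigcup_{g\in G}(\exp_{\prec_1}(g_{|h'=1})+\mathbb{N}^{2n+1})$. -/

import Mathlib

/-- Names of the variables of a homogenized Weyl algebra: `x_1, …, x_n`, the derivations
`∂_1, …, ∂_n`, and `m` central homogenizing variables. -/
inductive WeylVar (n m : ℕ) : Type
  | x (i : Fin n) : WeylVar n m
  | d (i : Fin n) : WeylVar n m
  | h (j : Fin m) : WeylVar n m

namespace HomogWeyl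

open WeylVar

/-- The defining relations: all variables commute, except that
`∂_i x_i = x_i ∂_i + h_1 ⋯ h_m`. -/
inductive Rel (K : Type*) [Field K] (n m : ℕ) :
    FreeAlgebra K (WeylVar n m) → FreeAlgebra K (WeylVar n m) → Prop
  | xx (i j : Fin n) : Rel K n m
      (FreeAlgebra.ι K (x i) * FreeAlgebra.ι K (x j))
      (FreeAlgebra.ι K (x j) * FreeAlgebra.ι K (x i))
  | dd (i j : Fin n) : Rel K n m
      (FreeAlgebra.ι K (d i) * FreeAlgebra.ι K (d j))
      (FreeAlgebra.ι K (d j) * FreeAlgebra.ι K (d i))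
  | dx_ne (i j : Fin n) (hij : i ≠ j) : Rel K n m
      (FreeAlgebra.ι K (d i) * FreeAlgebra.ι K (x j))
      (FreeAlgebra.ι K (x j) * FreeAlgebra.ι K (d i))
  | dx (i : Fin n) : Rel K n m
      (FreeAlgebra.ι K (d i) * FreeAlgebra.ι K (x i))
      (FreeAlgebra.ι K (x i) * FreeAlgebra.ι K (d i)
        + (List.ofFn fun j : Fin m => FreeAlgebra.ι K (h j)).prod)
  | hcomm (j : Fin m) (v : WeylVar n m) : Rel K n m
      (FreeAlgebra.ι K (h j) * FreeAlgebra.ι K v)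
      (FreeAlgebra.ι K v * FreeAlgebra.ι K (h j))

end HomogWeyl

/-- The `K`-algebra generated by `x_i`, `∂_i` and `m` central variables `h_j`, subject to the
relations `∂_i x_i = x_i ∂_i + h_1 ⋯ h_m` (and all other pairs of variables commuting). -/
abbrev HomogWeyl (K : Type*) [Field K] (n m : ℕ) : Type _ :=
  RingQuot (HomogWeyl.Rel K n m)

/-- The homogenized Weyl algebra `h_(0,1)(D)`: one variable `h`, with
`∂_i x_i = x_i ∂_i + h`. -/
abbrev HWeyl (K : Type*) [Field K] (n : ℕ) : Type _ := HomogWeyl K n 1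

/-- The doubly homogenized Weyl algebra `h'(D)`: two variables `h` (index `0`) and `h'`
(index `1`), with `∂_i x_i = x_i ∂_i + h h'`. -/
abbrev DoubleHWeyl (K : Type*) [Field K] (n : ℕ) : Type _ := HomogWeyl K n 2

namespace HomogWeyl

open WeylVar

section Basis

variable (K : Type*) [Field K] {n m : ℕ}

/-- The class of a variable in the algebra. -/
noncomputable def var (v : WeylVar n m) : HomogWeyl K n m :=
  RingQuot.mkAlgHom K (Rel K n m) (FreeAlgebra.ι K v)

/-- The product `h_1 ⋯ h_m` of the homogenizing variables. -/
noncomputable def hprod (n m : ℕ) : HomogWeyl K n m :=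
  (List.ofFn fun j : Fin m => var K (n := n) (h j)).prod

theorem var_xx (i j : Fin n) :
    var K (m := m) (x i) * var K (x j) = var K (x j) * var K (x i) := by
  simpa [var] using RingQuot.mkAlgHom_rel K (Rel.xx (K := K) (m := m) i j)

theorem var_dd (i j : Fin n) :
    var K (m := m) (d i) * var K (d j) = var K (d j) * var K (d i) := by
  simpa [var] using RingQuot.mkAlgHom_rel K (Rel.dd (K := K) (m := m) i j)

theorem var_dx_ne (i j : Fin n) (hij : i ≠ j) :
    var K (m := m) (d i) * var K (x j) = var K (x j) * var K (d i) := by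
  simpa [var] using RingQuot.mkAlgHom_rel K (Rel.dx_ne (K := K) (m := m) i j hij)

theorem var_dx (i : Fin n) :
    var K (m := m) (d i) * var K (x i) = var K (x i) * var K (d i) + hprod K n m := by
  have := RingQuot.mkAlgHom_rel K (Rel.dx (K := K) (m := m) i)
  simpa [var, hprod, map_list_prod, List.map_ofFn, Function.comp_def] using this

theorem var_h (j : Fin m) (v : WeylVar n m) :
    var K (h j) * var K v = var K v * var K (h j) := by
  simpa [var] using RingQuot.mkAlgHom_rel K (Rel.hcomm (K := K) j v)

/-- The normally ordered monomial `x^α ∂^β h^γ` whose exponents are recorded by `e`. -/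
noncomputable def normalMonomial (e : WeylVar n m →₀ ℕ) : HomogWeyl K n m :=
  (List.ofFn fun i : Fin n => var K (m := m) (x i) ^ e (x i)).prod
    * (List.ofFn fun i : Fin n => var K (m := m) (d i) ^ e (d i)).prod
    * (List.ofFn fun j : Fin m => var K (n := n) (h j) ^ e (h j)).prod

theorem prod_succ_eq {A : Type*} [Monoid A] {N : ℕ} (f : Fin N → A)
    (hf : ∀ i j, f i * f j = f j * f i) (a b : Fin N → ℕ) (i : Fin N)
    (hi : b i = a i + 1) (hne : ∀ j, j ≠ i → b j = a j) :
    (List.ofFn fun j => f j ^ b j).prod = f i * (List.ofFn fun j => f j ^ a j).prod := by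
  induction N with
  | zero => exact i.elim0
  | succ N ih =>
    rw [List.ofFn_succ, List.ofFn_succ, List.prod_cons, List.prod_cons]
    rcases Fin.eq_zero_or_eq_succ i with rfl | ⟨k, rfl⟩
    · rw [hi, pow_succ', mul_assoc]
      congr 3
      exact congrArg _ (funext fun j => by rw [hne _ (Fin.succ_ne_zero j)])
    · rw [hne 0 (Fin.succ_ne_zero k).symm,
        ih (fun j => f j.succ) (fun _ _ => hf _ _) (fun j => a j.succ) (fun j => b j.succ) k hi
          (fun j hj => hne _ (fun hh => hj (Fin.succ_injective _ hh))), ← mul_assoc, ← mul_assoc]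
      congr 1
      exact ((show Commute (f 0) (f k.succ) from hf _ _).pow_left _).eq

theorem commute_list {A : Type*} [Monoid A] {N : ℕ} (f : Fin N → A) (a : Fin N → ℕ) (y : A)
    (hy : ∀ i, Commute y (f i)) : Commute y (List.ofFn fun j => f j ^ a j).prod := by
  apply Commute.list_prod_right
  intro z hz
  obtain ⟨j, rfl⟩ := (List.mem_ofFn' _ _).1 hz
  exact (hy j).pow_right _

theorem normalMonomial_zero : normalMonomial K (0 : WeylVar n m →₀ ℕ) = 1 := by
  simp [normalMonomial]

theorem normalMonomial_x (e : WeylVar n m →₀ ℕ) (i : Fin n) :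
    normalMonomial K (e + Finsupp.single (x i) 1) = var K (x i) * normalMonomial K e := by
  classical
  simp only [normalMonomial]
  rw [prod_succ_eq (fun i => var K (m := m) (x i)) (var_xx K) (fun j => e (x j)) _ i]
  · simp [mul_assoc]
  · simp
  · intro j hj
    simp [hj.symm]

theorem normalMonomial_h (e : WeylVar n m →₀ ℕ) (i : Fin m) :
    normalMonomial K (e + Finsupp.single (h i) 1) = var K (h i) * normalMonomial K e := by
  classical
  simp only [normalMonomial]
  rw [prod_succ_eq (fun i => var K (n := n) (h i)) (fun _ _ => var_h K _ _) (fun j => e (h j)) _ i]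
  · have h1 := commute_list (fun i => var K (m := m) (x i)) (fun j => e (x j)) (var K (h i))
      (fun j => var_h K i (x j))
    have h2 := commute_list (fun i => var K (m := m) (d i)) (fun j => e (d j)) (var K (h i))
      (fun j => var_h K i (d j))
    have h3 := (h1.mul_right h2).eq
    simp only [Finsupp.add_apply, Finsupp.single_apply, reduceCtorEq, if_false, add_zero]
    rw [← mul_assoc, ← mul_assoc, h3]
  · simp
  · intro j hj
    simp [hj.symm]

theorem normalMonomial_d (e : WeylVar n m →₀ ℕ) (i : Fin n) (he : ∀ j, e (x j) = 0) :
    normalMonomial K (e + Finsupp.single (d i) 1) = var K (d i) * normalMonomial K e := by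
  classical
  simp only [normalMonomial]
  rw [prod_succ_eq (fun i => var K (m := m) (d i)) (var_dd K) (fun j => e (d j)) _ i]
  · simp [he, mul_assoc]
  · simp
  · intro j hj
    simp [hj.symm]

/-- The action of a variable on commutative polynomials: `x_i` and `h_j` act by multiplication,
`∂_i` acts as `f ↦ ξ_i f + h_1 ⋯ h_m ∂f/∂x_i`, where `ξ_i` is the polynomial variable
named `d i`. -/
noncomputable def act : WeylVar n m → Module.End K (MvPolynomial (WeylVar n m) K)
  | x i => LinearMap.mulLeft K (MvPolynomial.X (x i))
  | d i => LinearMap.mulLeft K (MvPolynomial.X (d i))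
      + LinearMap.mulLeft K (∏ j : Fin m, MvPolynomial.X (h j))
        ∘ₗ (MvPolynomial.pderiv (R := K) (x i)).toLinearMap
  | h j => LinearMap.mulLeft K (MvPolynomial.X (h j))

theorem act_hprod (f : MvPolynomial (WeylVar n m) K) :
    (List.ofFn fun j : Fin m => act K (n := n) (h j)).prod f
      = (∏ j : Fin m, MvPolynomial.X (h j)) * f := by
  have : (List.ofFn fun j : Fin m => act K (n := n) (h j))
      = (List.ofFn fun j : Fin m =>
          (MvPolynomial.X (h j) : MvPolynomial (WeylVar n m) K)).map
          (Algebra.lmul K (MvPolynomial (WeylVar n m) K)) := by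
    rw [List.map_ofFn]
    rfl
  rw [this, ← map_list_prod, List.prod_ofFn]
  rfl

theorem pderiv_prod_h (i : Fin n) : MvPolynomial.pderiv (R := K) (x i)
    (∏ j : Fin m, (MvPolynomial.X (h j) : MvPolynomial (WeylVar n m) K)) = 0 := by
  classical
  refine Finset.prod_induction _ (fun p => MvPolynomial.pderiv (R := K) (x i) p = 0) ?_ ?_ ?_
  · intro a b ha hb
    simp [Derivation.leibniz, ha, hb]
  · simp
  · intro j _
    simp [MvPolynomial.pderiv_X]

theorem pderiv_comm (i j : Fin n) (f : MvPolynomial (WeylVar n m) K) :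
    MvPolynomial.pderiv (x i) (MvPolynomial.pderiv (x j) f)
      = MvPolynomial.pderiv (x j) (MvPolynomial.pderiv (x i) f) := by
  classical
  have : ⁅MvPolynomial.pderiv (R := K) (x i : WeylVar n m),
      MvPolynomial.pderiv (R := K) (x j : WeylVar n m)⁆ = 0 := by
    apply MvPolynomial.derivation_ext
    intro v
    rw [Derivation.commutator_apply]
    simp only [MvPolynomial.pderiv_X, Pi.single_apply]
    split_ifs <;> simp
  have h2 := congrArg (fun D => D f) this
  simpa [Derivation.commutator_apply, sub_eq_zero] using h2

theorem act_rel {a b : FreeAlgebra K (WeylVar n m)} (hab : Rel K n m a b) :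
    FreeAlgebra.lift K (act K) a = FreeAlgebra.lift K (act K) b := by
  classical
  cases hab with
  | xx i j =>
    refine LinearMap.ext fun f => ?_
    simp [act, Module.End.mul_apply]
    ring
  | dd i j =>
    refine LinearMap.ext fun f => ?_
    simp [act, Module.End.mul_apply, Derivation.leibniz, MvPolynomial.pderiv_X, pderiv_prod_h,
      pderiv_comm K i j f]
    ring
  | dx_ne i j hij =>
    refine LinearMap.ext fun f => ?_
    simp [act, Module.End.mul_apply, Derivation.leibniz, MvPolynomial.pderiv_X, hij.symm]
    ring
  | dx i =>
    refine LinearMap.ext fun f => ?_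
    simp only [map_add, map_mul, FreeAlgebra.lift_ι_apply, map_list_prod, List.map_ofFn,
      Function.comp_def, LinearMap.add_apply, act_hprod]
    simp [act, Module.End.mul_apply, Derivation.leibniz, MvPolynomial.pderiv_X]
    ring
  | hcomm j v =>
    refine LinearMap.ext fun f => ?_
    cases v with
    | x i =>
      simp [act, Module.End.mul_apply]
      ring
    | d i =>
      simp [act, Module.End.mul_apply, Derivation.leibniz, MvPolynomial.pderiv_X]
      ring
    | h i =>
      simp [act, Module.End.mul_apply]
      ring

/-- The action of the whole algebra on commutative polynomials. -/
noncomputable def actHom :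
    HomogWeyl K n m →ₐ[K] Module.End K (MvPolynomial (WeylVar n m) K) :=
  RingQuot.liftAlgHom K ⟨FreeAlgebra.lift K (act K), fun _ _ hab => act_rel K hab⟩

theorem actHom_var (v : WeylVar n m) : actHom K (var K v) = act K v := by
  simp [actHom, var]

/-- The value of the action at the constant polynomial `1`. -/
noncomputable def symbolMap : HomogWeyl K n m →ₗ[K] MvPolynomial (WeylVar n m) K :=
  LinearMap.applyₗ (1 : MvPolynomial (WeylVar n m) K) ∘ₗ (actHom K).toLinearMap

/-- The linear map that sends a commutative monomial to the normally ordered monomial. -/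
noncomputable def orderMap : MvPolynomial (WeylVar n m) K →ₗ[K] HomogWeyl K n m :=
  (MvPolynomial.basisMonomials (WeylVar n m) K).constr K (normalMonomial K)

theorem orderMap_monomial (e : WeylVar n m →₀ ℕ) :
    orderMap K (MvPolynomial.monomial e 1) = normalMonomial K e := by
  have := (MvPolynomial.basisMonomials (WeylVar n m) K).constr_basis K (normalMonomial K) e
  simpa [orderMap] using this

theorem poly_induction {P : MvPolynomial (WeylVar n m) K → Prop}
    (hadd : ∀ f g, P f → P g → P (f + g)) (hsmul : ∀ (c : K) f, P f → P (c • f))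
    (hx : ∀ i f, P f → P (MvPolynomial.X (x i) * f))
    (hmon : ∀ e : WeylVar n m →₀ ℕ, (∀ j, e (x j) = 0) → P (MvPolynomial.monomial e 1))
    (f : MvPolynomial (WeylVar n m) K) : P f := by
  classical
  have key : ∀ (N : ℕ) (e : WeylVar n m →₀ ℕ), (∑ j : Fin n, e (x j)) = N →
      P (MvPolynomial.monomial e 1) := by
    intro N
    induction N with
    | zero =>
      intro e he
      exact hmon e fun j => (Finset.sum_eq_zero_iff.1 he) j (Finset.mem_univ j)
    | succ N ih =>
      intro e he
      obtain ⟨i, hi⟩ : ∃ i, e (x i) ≠ 0 := by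
        by_contra hcon
        push Not at hcon
        simp [hcon] at he
      have hle : Finsupp.single (x i : WeylVar n m) 1 ≤ e :=
        Finsupp.single_le_iff.2 (Nat.one_le_iff_ne_zero.2 hi)
      obtain ⟨e', rfl⟩ := exists_add_of_le hle
      have : P (MvPolynomial.X (x i) * MvPolynomial.monomial e' 1) := by
        apply hx
        apply ih
        simp [Finset.sum_add_distrib, Finsupp.single_apply] at he
        omega
      simpa [MvPolynomial.X, MvPolynomial.monomial_mul] using this
  induction f using MvPolynomial.induction_on' with
  | monomial e c =>
    have := hsmul c _ (key _ e rfl)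
    simpa [MvPolynomial.smul_monomial] using this
  | add p q hp hq => exact hadd _ _ hp hq

theorem orderMap_x (i : Fin n) (f : MvPolynomial (WeylVar n m) K) :
    orderMap K (MvPolynomial.X (x i) * f) = var K (x i) * orderMap K f := by
  induction f using MvPolynomial.induction_on' with
  | monomial e c =>
    have h1 : (MvPolynomial.monomial e c : MvPolynomial (WeylVar n m) K)
        = c • MvPolynomial.monomial e 1 := by simp [MvPolynomial.smul_monomial]
    rw [h1, mul_smul_comm, map_smul, map_smul, mul_smul_comm, mul_comm, MvPolynomial.X,
      MvPolynomial.monomial_mul, one_mul, orderMap_monomial, orderMap_monomial, normalMonomial_x]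
  | add p q hp hq => simp [mul_add, hp, hq]

theorem orderMap_h (i : Fin m) (f : MvPolynomial (WeylVar n m) K) :
    orderMap K (MvPolynomial.X (h i) * f) = var K (h i) * orderMap K f := by
  induction f using MvPolynomial.induction_on' with
  | monomial e c =>
    have h1 : (MvPolynomial.monomial e c : MvPolynomial (WeylVar n m) K)
        = c • MvPolynomial.monomial e 1 := by simp [MvPolynomial.smul_monomial]
    rw [h1, mul_smul_comm, map_smul, map_smul, mul_smul_comm, mul_comm, MvPolynomial.X,
      MvPolynomial.monomial_mul, one_mul, orderMap_monomial, orderMap_monomial, normalMonomial_h]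
  | add p q hp hq => simp [mul_add, hp, hq]

theorem orderMap_hprod (f : MvPolynomial (WeylVar n m) K) :
    orderMap K ((∏ j : Fin m, MvPolynomial.X (h j)) * f) = hprod K n m * orderMap K f := by
  have key : ∀ l : List (Fin m),
      orderMap K ((l.map fun j => MvPolynomial.X (h j)).prod * f)
        = (l.map fun j => var K (n := n) (h j)).prod * orderMap K f := by
    intro l
    induction l with
    | nil => simp
    | cons a l ih => simp only [List.map_cons, List.prod_cons, mul_assoc, orderMap_h, ih]
  have := key (List.finRange m)
  rw [← List.ofFn_eq_map, ← List.ofFn_eq_map, List.prod_ofFn] at this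
  exact this

theorem orderMap_act (v : WeylVar n m) (f : MvPolynomial (WeylVar n m) K) :
    orderMap K (act K v f) = var K v * orderMap K f := by
  classical
  cases v with
  | x i => exact orderMap_x K i f
  | h i => exact orderMap_h K i f
  | d i =>
    induction f using poly_induction with
    | hadd f g hf hg => simp only [map_add, hf, hg, mul_add]
    | hsmul c f hf => rw [map_smul, map_smul, hf, map_smul, mul_smul_comm]
    | hmon e he =>
      have h0 : MvPolynomial.pderiv (x i) (MvPolynomial.monomial e (1 : K)) = 0 := by
        rw [MvPolynomial.pderiv_monomial]
        simp [he]
      have h1 : act K (d i) (MvPolynomial.monomial e (1 : K))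
          = MvPolynomial.monomial (e + Finsupp.single (d i) 1) 1 := by
        simp [act, h0, MvPolynomial.X, MvPolynomial.monomial_mul, add_comm]
      rw [h1, orderMap_monomial, orderMap_monomial, normalMonomial_d K e i he]
    | hx j f hf =>
      by_cases hij : i = j
      · subst hij
        have h1 : act K (d i) (MvPolynomial.X (x i) * f)
            = MvPolynomial.X (x i) * act K (d i) f
              + (∏ j : Fin m, MvPolynomial.X (h j)) * f := by
          simp [act, Derivation.leibniz, MvPolynomial.pderiv_X]
          ring
        rw [h1, map_add, orderMap_x, orderMap_x, orderMap_hprod, hf, ← mul_assoc, ← mul_assoc,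
          var_dx, add_mul]
      · have h1 : act K (d i) (MvPolynomial.X (x j) * f)
            = MvPolynomial.X (x j) * act K (d i) f := by
          simp [act, Derivation.leibniz, MvPolynomial.pderiv_X, Ne.symm hij]
          ring
        rw [h1, orderMap_x, orderMap_x, hf, ← mul_assoc, ← mul_assoc, var_dx_ne K i j hij]

theorem orderMap_actHom (P : HomogWeyl K n m) (f : MvPolynomial (WeylVar n m) K) :
    orderMap K (actHom K P f) = P * orderMap K f := by
  obtain ⟨p, rfl⟩ := RingQuot.mkAlgHom_surjective K (Rel K n m) P
  induction p using FreeAlgebra.induction generalizing f with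
  | grade0 c =>
    rw [AlgHom.commutes, AlgHom.commutes, Module.algebraMap_end_apply, map_smul,
      Algebra.smul_def]
  | grade1 v =>
    have := orderMap_act K v f
    rwa [← actHom_var] at this
  | mul a b ha hb => rw [map_mul, map_mul, Module.End.mul_apply, ha, hb, mul_assoc]
  | add a b ha hb => rw [map_add, map_add, LinearMap.add_apply, map_add, ha, hb, add_mul]

theorem orderMap_symbolMap (P : HomogWeyl K n m) : orderMap K (symbolMap K P) = P := by
  have h1 : orderMap K (1 : MvPolynomial (WeylVar n m) K) = 1 := by
    have := orderMap_monomial K (0 : WeylVar n m →₀ ℕ)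
    rwa [normalMonomial_zero] at this
  have h2 := orderMap_actHom K P 1
  rw [h1, mul_one] at h2
  exact h2

theorem symbolMap_var_mul (v : WeylVar n m) (P : HomogWeyl K n m) :
    symbolMap K (var K v * P) = act K v (symbolMap K P) := by
  simp [symbolMap, Module.End.mul_apply, actHom_var]

theorem symbolMap_normalMonomial (e : WeylVar n m →₀ ℕ) :
    symbolMap K (normalMonomial K e) = MvPolynomial.monomial e 1 := by
  classical
  have hfree : ∀ (N : ℕ) (e : WeylVar n m →₀ ℕ), e.degree = N → (∀ j, e (x j) = 0) →
      symbolMap K (normalMonomial K e) = MvPolynomial.monomial e 1 := by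
    intro N
    induction N with
    | zero =>
      intro e he _
      rw [(Finsupp.degree_eq_zero_iff e).1 he, normalMonomial_zero]
      simp [symbolMap]
    | succ N ih =>
      intro e he hx
      obtain ⟨v, hv⟩ : ∃ v, e v ≠ 0 := by
        by_contra hcon
        push Not at hcon
        rw [Finsupp.ext (g := 0) hcon] at he
        simp at he
      obtain ⟨e', rfl⟩ := exists_add_of_le
        (Finsupp.single_le_iff.2 (Nat.one_le_iff_ne_zero.2 hv) : Finsupp.single v 1 ≤ e)
      have hx' : ∀ j, e' (x j) = 0 := fun j => by
        have := hx j
        rw [Finsupp.add_apply] at this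
        omega
      have hN : e'.degree = N := by
        rw [map_add, Finsupp.degree_single] at he
        omega
      have h0 : ∀ i, MvPolynomial.pderiv (x i) (MvPolynomial.monomial e' (1 : K)) = 0 := by
        intro i
        rw [MvPolynomial.pderiv_monomial]
        simp [hx']
      rw [add_comm]
      cases v with
      | x i => exact absurd (hx i) hv
      | d i =>
        rw [normalMonomial_d K e' i hx', symbolMap_var_mul, ih e' hN hx']
        simp [act, h0, MvPolynomial.X, MvPolynomial.monomial_mul, add_comm]
      | h i =>
        rw [normalMonomial_h K e' i, symbolMap_var_mul, ih e' hN hx']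
        simp [act, MvPolynomial.X, MvPolynomial.monomial_mul, add_comm]
  have key : ∀ f : MvPolynomial (WeylVar n m) K, symbolMap K (orderMap K f) = f := by
    intro f
    induction f using poly_induction with
    | hadd f g hf hg => simp only [map_add, hf, hg]
    | hsmul c f hf => simp only [map_smul, hf]
    | hx i f hf =>
      rw [orderMap_x, symbolMap_var_mul, hf]
      rfl
    | hmon e he => rw [orderMap_monomial, hfree _ e rfl he]
  have := key (MvPolynomial.monomial e 1)
  rwa [orderMap_monomial] at this

theorem symbolMap_orderMap (f : MvPolynomial (WeylVar n m) K) :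
    symbolMap K (orderMap K f) = f := by
  induction f using MvPolynomial.induction_on' with
  | monomial e c =>
    have h1 : (MvPolynomial.monomial e c : MvPolynomial (WeylVar n m) K)
        = c • MvPolynomial.monomial e 1 := by simp [MvPolynomial.smul_monomial]
    rw [h1, map_smul, map_smul, orderMap_monomial, symbolMap_normalMonomial]
  | add p q hp hq => simp only [map_add, hp, hq]

/-- The normally ordered monomials `x^α ∂^β h^γ` form a `K`-basis. -/
noncomputable def normalBasis (n m : ℕ) :
    Module.Basis (WeylVar n m →₀ ℕ) K (HomogWeyl K n m) :=
  (MvPolynomial.basisMonomials (WeylVar n m) K).map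
    { orderMap K with
      invFun := symbolMap K
      left_inv := symbolMap_orderMap K
      right_inv := orderMap_symbolMap K }

theorem normalBasis_apply (e : WeylVar n m →₀ ℕ) :
    normalBasis K n m e = normalMonomial K e := by
  have := orderMap_monomial K e
  simpa [normalBasis] using this

end Basis

section Exponents

variable {K : Type*} [Field K] {n m : ℕ}

/-- The support `ND(P)`: the exponents that occur in the unique expansion of `P` in normally
ordered monomials. -/
noncomputable def support (P : HomogWeyl K n m) : Finset (WeylVar n m →₀ ℕ) :=
  ((normalBasis K n m).repr P).support

/-- `e` is the leading exponent of `P` for the strict order `lt`: the largest element of the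
support (so `P` is nonzero). -/
def IsLeadingExp (lt : (WeylVar n m →₀ ℕ) → (WeylVar n m →₀ ℕ) → Prop)
    (P : HomogWeyl K n m) (e : WeylVar n m →₀ ℕ) : Prop :=
  e ∈ support P ∧ ∀ e' ∈ support P, e' ≠ e → lt e' e

/-- `Exp(J)`: the set of leading exponents of the nonzero elements of the left ideal `J`. -/
def leadingExps (lt : (WeylVar n m →₀ ℕ) → (WeylVar n m →₀ ℕ) → Prop)
    (J : Ideal (HomogWeyl K n m)) : Set (WeylVar n m →₀ ℕ) :=
  {e | ∃ P ∈ J, IsLeadingExp lt P e}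

/-- The union of the sets `exp(g) + ℕ^{2n+m}`, `g ∈ G`. -/
def leadingCone (lt : (WeylVar n m →₀ ℕ) → (WeylVar n m →₀ ℕ) → Prop)
    (G : Set (HomogWeyl K n m)) : Set (WeylVar n m →₀ ℕ) :=
  {e | ∃ g ∈ G, ∃ a c : WeylVar n m →₀ ℕ, IsLeadingExp lt g a ∧ e = a + c}

/-- `G` is a Gröbner basis of the left ideal `J`: a finite set of nonzero elements of `J` whose
leading exponents generate `Exp(J)`. -/
def IsGroebnerBasis (lt : (WeylVar n m →₀ ℕ) → (WeylVar n m →₀ ℕ) → Prop)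
    (J : Ideal (HomogWeyl K n m)) (G : Set (HomogWeyl K n m)) : Prop :=
  G.Finite ∧ (0 : HomogWeyl K n m) ∉ G ∧ G ⊆ J ∧ leadingExps lt J = leadingCone lt G

/-- `G` is a standard basis of the left ideal `I`: a finite set of nonzero elements that
generates `I` and whose leading exponents generate `Exp(I)`. -/
def IsStandardBasis (lt : (WeylVar n m →₀ ℕ) → (WeylVar n m →₀ ℕ) → Prop)
    (I : Ideal (HomogWeyl K n m)) (G : Set (HomogWeyl K n m)) : Prop :=
  G.Finite ∧ (0 : HomogWeyl K n m) ∉ G ∧ Ideal.span G = I ∧ leadingExps lt I = leadingCone lt G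

/-- `P` is homogeneous for the total degree in all variables. -/
def IsHomogeneous (P : HomogWeyl K n m) : Prop :=
  ∃ N : ℕ, ∀ e ∈ support P, e.degree = N

/-- `J` can be generated, as a left ideal, by homogeneous elements. -/
def IsHomogeneousIdeal (J : Ideal (HomogWeyl K n m)) : Prop :=
  ∃ S : Set (HomogWeyl K n m), (∀ P ∈ S, IsHomogeneous P) ∧ J = Ideal.span S

end Exponents

section Orders

variable {n : ℕ}

/-- `lt` is a strict total order on the monomials `x^α ∂^β h^k` of `h_(0,1)(D)`, compatible with
multiplication, such that `x_i ∂_i ≻ h`, monomials of larger degree `|β| + k` are larger,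
and `x^α ⪯ 1`. -/
structure IsLocalOrder (lt : (WeylVar n 1 →₀ ℕ) → (WeylVar n 1 →₀ ℕ) → Prop) : Prop where
  strictTotal : IsStrictTotalOrder (WeylVar n 1 →₀ ℕ) lt
  add_right : ∀ a b c, lt a b → lt (a + c) (b + c)
  h_lt_x_d : ∀ i : Fin n,
    lt (Finsupp.single (h 0) 1) (Finsupp.single (x i) 1 + Finsupp.single (d i) 1)
  lt_of_degree_lt : ∀ a b : WeylVar n 1 →₀ ℕ,
    (∑ i, a (d i)) + a (h 0) < (∑ i, b (d i)) + b (h 0) → lt a b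
  x_le_one : ∀ a : WeylVar n 1 →₀ ℕ, (∀ i, a (d i) = 0) → a (h 0) = 0 → a = 0 ∨ lt a 0

/-- The inclusion of the variables `x_i, ∂_i, h` into `x_i, ∂_i, h, h'`. -/
def inclVar : WeylVar n 1 → WeylVar n 2
  | x i => x i
  | d i => d i
  | h _ => h 0

theorem inclVar_injective : Function.Injective (inclVar (n := n)) := by
  rintro (i | i | i) (j | j | j) hij <;> simp_all [inclVar]
  exact Subsingleton.elim _ _

/-- The exponent of `x^α ∂^β h^k` obtained from that of `x^α ∂^β h^k h'^l`. -/
noncomputable def forget (e : WeylVar n 2 →₀ ℕ) : WeylVar n 1 →₀ ℕ :=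
  e.comapDomain inclVar inclVar_injective.injOn

/-- The block order on the monomials `x^α ∂^β h^k h'^l`: compare the total degrees
`|α| + |β| + k + l` first, then `x^α ∂^β h^k` by the given order. -/
def blockOrder (lt : (WeylVar n 1 →₀ ℕ) → (WeylVar n 1 →₀ ℕ) → Prop)
    (a b : WeylVar n 2 →₀ ℕ) : Prop :=
  a.degree < b.degree ∨ (a.degree = b.degree ∧ lt (forget a) (forget b))

end Orders

section Dehomogenization

variable (K : Type*) [Field K] (n : ℕ)

/-- The images of the variables under `h' ↦ 1`. -/
noncomputable def dehomVar : WeylVar n 2 → HWeyl K n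
  | x i => var K (x i)
  | d i => var K (d i)
  | h j => if j = 0 then var K (h 0) else 1

theorem dehom_rel {a b : FreeAlgebra K (WeylVar n 2)} (hab : Rel K n 2 a b) :
    FreeAlgebra.lift K (dehomVar K n) a = FreeAlgebra.lift K (dehomVar K n) b := by
  cases hab with
  | xx i j => simp [dehomVar, var_xx K i j]
  | dd i j => simp [dehomVar, var_dd K i j]
  | dx_ne i j hij => simp [dehomVar, var_dx_ne K i j hij]
  | dx i => simp [dehomVar, var_dx K i, hprod]
  | hcomm j v =>
    by_cases hj : j = 0
    · by_cases hv : v = h 1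
      · subst hv
        simp [dehomVar]
      · cases v with
        | x i => simp [dehomVar, hj, var_h]
        | d i => simp [dehomVar, hj, var_h]
        | h i =>
          by_cases hi : i = 0 <;> simp [dehomVar, hj, hi]
    · simp [dehomVar, hj]

/-- The dehomogenization `P ↦ P|_{h'=1}` from `h'(D)` to `h_(0,1)(D)`: the algebra morphism that
fixes `x_i`, `∂_i`, `h` and sends `h'` to `1`. -/
noncomputable def dehom : DoubleHWeyl K n →ₐ[K] HWeyl K n :=
  RingQuot.liftAlgHom K ⟨FreeAlgebra.lift K (dehomVar K n), fun _ _ hab => dehom_rel K n hab⟩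

end Dehomogenization

end HomogWeyl

namespace HomogWeyl

open WeylVar

/-! ### Exponents occurring in a product with a variable -/

section Support

variable {K : Type*} [Field K] {n m : ℕ}

/-! On elements of a fixed total degree, setting `h' = 1` loses nothing: the exponent of `h'` is
recovered from the degree and the other exponents. Hence no terms merge, and since `blockOrder`
compares exponents of equal degree by `lt`, the leading exponent of a homogeneous element is carried
by `forget` to that of its dehomogenization (`IsLeadingExp.dehom`).

Every element of `I` is moreover the dehomogenization of a homogeneous element of `J`: sums are
lifted after equalizing degrees by powers of `h'` (`HasHomogeneousLift.add`). Thus leading exponents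
in `I` come from leading exponents of homogeneous elements of `J`, which lie in the cone of `G`. For
the converse inclusion, leading exponents must add under left multiplication by monomials; this is
where `x_i ∂_i ≻ h` enters, making the correction term `h h'` of the commutator smaller than `x_i
∂_i` (`IsLeadingExp.var_mul`).

That `G` after dehomogenization generates `I` follows by dividing homogeneous lifts by `G`. The
order `lt` need not be a well-order, but division within one degree meets only finitely many
exponents and therefore stops (`IsGroebnerBasis.mem_span_of_isHomogeneousOfDegree`). -/

theorem support_eq_support_symbolMap (P : HomogWeyl K n m) :
    support P = (symbolMap K P).support := rfl

theorem support_zero : support (0 : HomogWeyl K n m) = ∅ := by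
  simp [support]

theorem mem_support_add {P Q : HomogWeyl K n m} {e : WeylVar n m →₀ ℕ}
    (he : e ∈ support (P + Q)) : e ∈ support P ∨ e ∈ support Q := by
  classical
  rw [support, map_add] at he
  exact Finset.mem_union.1 (Finsupp.support_add he)

theorem mem_support_smul {P : HomogWeyl K n m} {c : K} {e : WeylVar n m →₀ ℕ}
    (he : e ∈ support (c • P)) : e ∈ support P := by
  rw [support, map_smul] at he
  exact Finsupp.support_smul he

theorem eq_zero_of_support_eq_empty {P : HomogWeyl K n m} (hP : support P = ∅) : P = 0 := by
  rw [support, Finsupp.support_eq_empty] at hP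
  exact (normalBasis K n m).repr.map_eq_zero_iff.1 hP

theorem exists_of_mem_support_X_mul {σ : Type*} {s : σ} {p : MvPolynomial σ K} {w : σ →₀ ℕ}
    (hw : w ∈ (MvPolynomial.X s * p).support) :
    ∃ w' ∈ p.support, w = w' + Finsupp.single s 1 := by
  classical
  rw [MvPolynomial.support_X_mul, Finset.mem_map] at hw
  obtain ⟨w', hw', rfl⟩ := hw
  exact ⟨w', hw', add_comm _ _⟩

theorem mem_support_pderiv {σ : Type*} {s : σ} {p : MvPolynomial σ K} {w : σ →₀ ℕ}
    (hw : w ∈ (MvPolynomial.pderiv s p).support) : w + Finsupp.single s 1 ∈ p.support := by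
  rw [MvPolynomial.mem_support_iff, MvPolynomial.coeff_pderiv] at hw
  exact MvPolynomial.mem_support_iff.2 (left_ne_zero_of_mul hw)

/-- `e` arises from `e'` by the term `h h' ∂/∂x_i` of the action of `v = ∂_i`. -/
def IsDerivedExp (v : WeylVar n 2) (e' e : WeylVar n 2 →₀ ℕ) : Prop :=
  ∃ i, v = d i ∧ e + Finsupp.single (x i) 1
    = e' + Finsupp.single (h 0) 1 + Finsupp.single (h 1) 1

/-- Separates the commutative product from the commutator correction, which is nonzero only for `v =
∂_i`. Only the support of the correction matters later, so its coefficients are left unspecified. -/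
theorem act_eq_add (v : WeylVar n 2) (f : MvPolynomial (WeylVar n 2) K) :
    ∃ r : MvPolynomial (WeylVar n 2) K, act K v f = MvPolynomial.X v * f + r ∧
      ∀ e ∈ r.support, ∃ e' ∈ f.support, IsDerivedExp v e' e := by
  cases v with
  | x i => exact ⟨0, by simp [act], by simp⟩
  | h i => exact ⟨0, by simp [act], by simp⟩
  | d i =>
    refine ⟨MvPolynomial.X (h 0) * (MvPolynomial.X (h 1) * MvPolynomial.pderiv (x i) f),
      by simp [act], fun e he => ?_⟩
    obtain ⟨e₁, he₁, rfl⟩ := exists_of_mem_support_X_mul he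
    obtain ⟨e₂, he₂, rfl⟩ := exists_of_mem_support_X_mul he₁
    exact ⟨_, mem_support_pderiv he₂, i, rfl, by abel⟩

theorem exists_of_mem_support_var_mul {v : WeylVar n 2} {P : DoubleHWeyl K n}
    {e : WeylVar n 2 →₀ ℕ} (he : e ∈ support (var K v * P)) :
    ∃ e' ∈ support P, e = e' + Finsupp.single v 1 ∨ IsDerivedExp v e' e := by
  classical
  rw [support_eq_support_symbolMap, symbolMap_var_mul] at he
  obtain ⟨r, hr, hr'⟩ := act_eq_add v (symbolMap K P)
  rw [hr] at he
  rcases Finset.mem_union.1 (MvPolynomial.support_add he) with he | he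
  · obtain ⟨e', h1, h2⟩ := exists_of_mem_support_X_mul he
    exact ⟨e', h1, .inl h2⟩
  · obtain ⟨e', h1, h2⟩ := hr' e he
    exact ⟨e', h1, .inr h2⟩

/-- The hypothesis `hv` keeps the correction term away from this exponent, so nothing can cancel the
commutative contribution. -/
theorem mem_support_var_mul {v : WeylVar n 2} {P : DoubleHWeyl K n} {e : WeylVar n 2 →₀ ℕ}
    (he : e ∈ support P) (hv : ∀ e' ∈ support P, ¬ IsDerivedExp v e' (e + Finsupp.single v 1)) :
    e + Finsupp.single v 1 ∈ support (var K v * P) := by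
  obtain ⟨r, hr, hr'⟩ := act_eq_add v (symbolMap K P)
  have h0 : e + Finsupp.single v 1 ∉ r.support := fun hmem =>
    let ⟨e', h1, h2⟩ := hr' _ hmem
    hv e' h1 h2
  rw [support_eq_support_symbolMap, symbolMap_var_mul, hr, MvPolynomial.mem_support_iff,
    MvPolynomial.coeff_add, MvPolynomial.notMem_support_iff.1 h0, add_zero, add_comm e,
    MvPolynomial.coeff_X_mul]
  exact MvPolynomial.mem_support_iff.1 he

end Support

/-! ### Homogeneity and left multiplication -/

section Homogeneous

variable {K : Type*} [Field K] {n m : ℕ}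

/-- All monomials of `P` have total degree `N`. -/
def IsHomogeneousOfDegree (P : HomogWeyl K n m) (N : ℕ) : Prop :=
  ∀ e ∈ support P, e.degree = N

theorem IsHomogeneousOfDegree.zero (N : ℕ) :
    IsHomogeneousOfDegree (0 : HomogWeyl K n m) N := by
  simp [IsHomogeneousOfDegree, support_zero]

theorem IsHomogeneousOfDegree.add {P Q : HomogWeyl K n m} {N : ℕ}
    (hP : IsHomogeneousOfDegree P N) (hQ : IsHomogeneousOfDegree Q N) :
    IsHomogeneousOfDegree (P + Q) N :=
  fun e he => (mem_support_add he).elim (hP e) (hQ e)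

theorem IsHomogeneousOfDegree.smul {P : HomogWeyl K n m} {N : ℕ}
    (hP : IsHomogeneousOfDegree P N) (c : K) : IsHomogeneousOfDegree (c • P) N :=
  fun e he => hP e (mem_support_smul he)

theorem IsDerivedExp.degree_eq {v : WeylVar n 2} {e' e : WeylVar n 2 →₀ ℕ}
    (he : IsDerivedExp v e' e) : e.degree = e'.degree + 1 := by
  obtain ⟨i, -, hi⟩ := he
  have := congrArg Finsupp.degree hi
  simp only [map_add, Finsupp.degree_single] at this
  omega

/-- The correction term loses one `x_i` and gains `h` and `h'`, so it has the same degree as the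
commutative term. This is the purpose of `h'`: with `h` alone the defining relation is not
homogeneous. -/
theorem IsHomogeneousOfDegree.var_mul {P : DoubleHWeyl K n} {N : ℕ}
    (hP : IsHomogeneousOfDegree P N) (v : WeylVar n 2) :
    IsHomogeneousOfDegree (var K v * P) (N + 1) := by
  intro e he
  obtain ⟨e', he', rfl | hd⟩ := exists_of_mem_support_var_mul he
  · rw [map_add, Finsupp.degree_single, hP e' he']
  · rw [hd.degree_eq, hP e' he']

theorem IsHomogeneousOfDegree.var_pow_mul {P : DoubleHWeyl K n} {N : ℕ}
    (hP : IsHomogeneousOfDegree P N) (v : WeylVar n 2) (k : ℕ) :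
    IsHomogeneousOfDegree (var K v ^ k * P) (N + k) := by
  induction k with
  | zero => simpa using hP
  | succ k ih =>
    rw [pow_succ', mul_assoc]
    exact ih.var_mul v

end Homogeneous

/-! ### The map `forget` and the block order -/

section Order

variable {n : ℕ}

theorem forget_apply (e : WeylVar n 2 →₀ ℕ) (v : WeylVar n 1) : forget e v = e (inclVar v) := rfl

theorem forget_add (a b : WeylVar n 2 →₀ ℕ) : forget (a + b) = forget a + forget b :=
  Finsupp.ext fun _ => rfl

theorem exists_forget_eq (e : WeylVar n 1 →₀ ℕ) : ∃ e', forget e' = e :=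
  ⟨e.mapDomain inclVar, Finsupp.ext fun v => Finsupp.mapDomain_apply inclVar_injective e v⟩

theorem forget_single (v : WeylVar n 1) :
    forget (Finsupp.single (inclVar v) 1) = Finsupp.single v 1 := by
  classical
  ext w
  simp [forget_apply, Finsupp.single_apply, inclVar_injective.eq_iff]

theorem forget_single_h_one :
    forget (Finsupp.single (h 1) 1 : WeylVar n 2 →₀ ℕ) = 0 := by
  classical
  ext w
  cases w <;> simp [forget_apply, inclVar]

/-- Lets the degree be written as a sum over all variables, and makes the exponents of bounded
degree finite in number. -/
instance (m : ℕ) : Finite (WeylVar n m) := by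
  refine Finite.of_surjective
    (fun s : Fin n ⊕ Fin n ⊕ Fin m => Sum.elim x (Sum.elim d h) s) ?_
  rintro (i | i | i)
  · exact ⟨.inl i, rfl⟩
  · exact ⟨.inr (.inl i), rfl⟩
  · exact ⟨.inr (.inr i), rfl⟩

/-- Only the exponent of `h'` is invisible to `forget`, and the total degree determines it. Both the
totality of `blockOrder` and the faithfulness of dehomogenization in a fixed degree rest on this. -/
theorem eq_of_forget_eq_of_degree_eq {a b : WeylVar n 2 →₀ ℕ} (hf : forget a = forget b)
    (hd : a.degree = b.degree) : a = b := by
  classical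
  have key : ∀ v, v ≠ h 1 → a v = b v := by
    intro v hv
    have hw : ∃ w, inclVar w = v := by
      cases v with
      | x i => exact ⟨x i, rfl⟩
      | d i => exact ⟨d i, rfl⟩
      | h i =>
        have hi : i = 0 := by
          have : i ≠ 1 := fun hi => hv (by rw [hi])
          omega
        exact ⟨h 0, by rw [hi]; rfl⟩
    obtain ⟨w, rfl⟩ := hw
    exact DFunLike.congr_fun hf w
  have := Fintype.ofFinite (WeylVar n 2)
  rw [Finsupp.degree_eq_sum, Finsupp.degree_eq_sum,
    ← Finset.add_sum_erase _ _ (Finset.mem_univ (h 1 : WeylVar n 2)),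
    ← Finset.add_sum_erase _ b (Finset.mem_univ (h 1 : WeylVar n 2)),
    Finset.sum_congr rfl fun v hv => key v (Finset.ne_of_mem_erase hv),
    add_left_inj] at hd
  ext v
  by_cases hv : v = h 1
  · rw [hv, hd]
  · exact key v hv

variable {lt : (WeylVar n 1 →₀ ℕ) → (WeylVar n 1 →₀ ℕ) → Prop}

theorem IsLocalOrder.blockOrder_strictTotal (hlt : IsLocalOrder lt) :
    IsStrictTotalOrder (WeylVar n 2 →₀ ℕ) (blockOrder lt) := by
  have := hlt.strictTotal
  refine { trichotomous := ?_, irrefl := ?_, trans := ?_ }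
  · intro a b hab hba
    simp only [blockOrder, not_or, not_and] at hab hba
    have hd : a.degree = b.degree := by omega
    exact eq_of_forget_eq_of_degree_eq
      (Std.Trichotomous.trichotomous (r := lt) _ _ (hab.2 hd) (hba.2 hd.symm)) hd
  · rintro a (ha | ⟨-, ha⟩)
    · exact lt_irrefl _ ha
    · exact irrefl_of lt _ ha
  · rintro a b c (h1 | ⟨h1, h1'⟩) (h2 | ⟨h2, h2'⟩)
    · exact .inl (h1.trans h2)
    · exact .inl (h2 ▸ h1)
    · exact .inl (h1 ▸ h2)
    · exact .inr ⟨h1.trans h2, trans_of lt h1' h2'⟩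

theorem IsLocalOrder.blockOrder_add_right (hlt : IsLocalOrder lt) {a b : WeylVar n 2 →₀ ℕ}
    (hab : blockOrder lt a b) (c : WeylVar n 2 →₀ ℕ) : blockOrder lt (a + c) (b + c) := by
  rcases hab with hab | ⟨h1, h2⟩
  · left
    rw [map_add, map_add]
    omega
  · right
    rw [map_add, map_add, forget_add, forget_add]
    exact ⟨by omega, hlt.add_right _ _ _ h2⟩

/-- The degrees agree, so `lt` decides. After forgetting `h'`, `e` is `e'` with one `x_i` traded for
`h`; adding `x_i` to both sides reduces the claim to `h ≺ x_i ∂_i`. -/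
theorem IsLocalOrder.blockOrder_of_isDerivedExp (hlt : IsLocalOrder lt) {v : WeylVar n 2}
    {e' e : WeylVar n 2 →₀ ℕ} (he : IsDerivedExp v e' e) :
    blockOrder lt e (e' + Finsupp.single v 1) := by
  refine .inr ⟨by rw [he.degree_eq, map_add, Finsupp.degree_single], ?_⟩
  have hst := hlt.strictTotal
  obtain ⟨i, rfl, hi⟩ := he
  have h1 : forget e + Finsupp.single (x i) 1 = forget e' + Finsupp.single (h 0) 1 := by
    have := congrArg forget hi
    rw [forget_add, forget_add, forget_add, forget_single_h_one, add_zero] at this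
    rwa [← forget_single, ← forget_single]
  have h2 := hlt.add_right _ _ (forget e') (hlt.h_lt_x_d i)
  rw [forget_add, show forget (Finsupp.single (d i) 1) = Finsupp.single (d i) 1 from
    forget_single (d i)]
  rw [add_comm _ (forget e'), ← h1, add_comm (Finsupp.single (x i) 1), add_comm _ (forget e'),
    ← add_assoc] at h2
  -- Compatibility only adds exponents; the common `x_i` in `h2` is cancelled by totality, since
  -- either other case would contradict `h2` after adding `x_i`.
  rcases trichotomous_of lt (forget e) (forget e' + Finsupp.single (d i) 1) with h3 | h3 | h3
  · exact h3
  · rw [← h3] at h2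
    exact absurd h2 (irrefl_of lt _)
  · exact absurd (trans_of lt h2 (hlt.add_right _ _ _ h3)) (irrefl_of lt _)

end Order

/-! ### Leading exponents under left multiplication -/

section LeadingExp

variable {K : Type*} [Field K] {n m : ℕ}

theorem IsLeadingExp.unique {lt : (WeylVar n m →₀ ℕ) → (WeylVar n m →₀ ℕ) → Prop}
    [IsStrictTotalOrder _ lt] {P : HomogWeyl K n m} {a b : WeylVar n m →₀ ℕ}
    (ha : IsLeadingExp lt P a) (hb : IsLeadingExp lt P b) : a = b := by
  by_contra hab
  exact asymm_of lt (ha.2 b hb.1 (Ne.symm hab)) (hb.2 a ha.1 hab)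

theorem exists_greatest_of_isStrictTotalOrder {α : Type*} (r : α → α → Prop)
    [IsStrictTotalOrder α r] {s : Finset α} (hs : s.Nonempty) :
    ∃ a ∈ s, ∀ b ∈ s, b ≠ a → r b a := by
  classical
  let := linearOrderOfSTO r
  obtain ⟨a, ha, hmax⟩ := Finset.exists_max_image s id hs
  exact ⟨a, ha, fun b hb hne => lt_of_le_of_ne (hmax b hb) hne⟩

theorem exists_isLeadingExp (lt : (WeylVar n m →₀ ℕ) → (WeylVar n m →₀ ℕ) → Prop)
    [IsStrictTotalOrder _ lt] {P : HomogWeyl K n m} (hP : P ≠ 0) :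
    ∃ e, IsLeadingExp lt P e := by
  exact exists_greatest_of_isStrictTotalOrder lt
    (Finset.nonempty_iff_ne_empty.2 fun h0 => hP (eq_zero_of_support_eq_empty h0))

theorem IsLeadingExp.ne_zero {lt : (WeylVar n m →₀ ℕ) → (WeylVar n m →₀ ℕ) → Prop}
    {P : HomogWeyl K n m} {e : WeylVar n m →₀ ℕ} (he : IsLeadingExp lt P e) : P ≠ 0 := by
  rintro rfl
  simpa [support_zero] using he.1

variable {lt : (WeylVar n 1 →₀ ℕ) → (WeylVar n 1 →₀ ℕ) → Prop}

/-- A correction term arising from `e'` lies strictly below `e' + v`, hence strictly below `e + v`.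
So corrections can neither cancel the expected leading term nor exceed it. -/
theorem IsLeadingExp.var_mul (hlt : IsLocalOrder lt) {P : DoubleHWeyl K n}
    {e : WeylVar n 2 →₀ ℕ} (he : IsLeadingExp (blockOrder lt) P e) (v : WeylVar n 2) :
    IsLeadingExp (blockOrder lt) (var K v * P) (e + Finsupp.single v 1) := by
  have := hlt.blockOrder_strictTotal
  have hle : ∀ e' ∈ support P, e' + Finsupp.single v 1 = e + Finsupp.single v 1 ∨
      blockOrder lt (e' + Finsupp.single v 1) (e + Finsupp.single v 1) := by
    intro e' he'
    by_cases heq : e' = e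
    · exact .inl (by rw [heq])
    · exact .inr (hlt.blockOrder_add_right (he.2 e' he' heq) _)
  have hlow : ∀ e' ∈ support P, ∀ w, IsDerivedExp v e' w →
      blockOrder lt w (e + Finsupp.single v 1) := by
    intro e' he' w hw
    have h1 := hlt.blockOrder_of_isDerivedExp hw
    rcases hle e' he' with h2 | h2
    · rwa [h2] at h1
    · exact trans_of (blockOrder lt) h1 h2
  refine ⟨mem_support_var_mul he.1 fun e' he' hd =>
    irrefl_of (blockOrder lt) _ (hlow e' he' _ hd), fun w hw hne => ?_⟩
  obtain ⟨e', he', rfl | hd⟩ := exists_of_mem_support_var_mul hw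
  · exact (hle e' he').resolve_left hne
  · exact hlow e' he' w hd

/-- Every multiple of a leading exponent of `P` is the leading exponent of a left multiple of
`P`. -/
theorem IsLeadingExp.exists_mul (hlt : IsLocalOrder lt) {P : DoubleHWeyl K n}
    {e : WeylVar n 2 →₀ ℕ} (he : IsLeadingExp (blockOrder lt) P e) {N : ℕ}
    (hN : IsHomogeneousOfDegree P N) (c : WeylVar n 2 →₀ ℕ) :
    ∃ Q : DoubleHWeyl K n, IsLeadingExp (blockOrder lt) (Q * P) (e + c) ∧
      IsHomogeneousOfDegree (Q * P) (N + c.degree) := by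
  induction hk : c.degree generalizing c with
  | zero =>
    rw [Finsupp.degree_eq_zero_iff] at hk
    subst hk
    exact ⟨1, by simpa using he, by simpa using hN⟩
  | succ k ih =>
    obtain ⟨v, hv⟩ : ∃ v, c v ≠ 0 := by
      by_contra! hcon
      rw [Finsupp.ext (g := 0) hcon] at hk
      simp at hk
    obtain ⟨c', rfl⟩ := exists_add_of_le
      (Finsupp.single_le_iff.2 (Nat.one_le_iff_ne_zero.2 hv) : Finsupp.single v 1 ≤ c)
    rw [map_add, Finsupp.degree_single] at hk
    obtain ⟨Q, h1, h2⟩ := ih c' (by omega)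
    refine ⟨var K v * Q, ?_, ?_⟩
    · rw [mul_assoc, add_comm _ c', ← add_assoc]
      exact h1.var_mul hlt v
    · rw [mul_assoc]
      exact h2.var_mul v

end LeadingExp

/-! ### Dehomogenization of homogeneous elements -/

section Dehom

variable {K : Type*} [Field K] {n : ℕ}

theorem dehom_var (v : WeylVar n 2) : dehom K n (var K v) = dehomVar K n v := by
  simp [dehom, var]

theorem dehom_var_inclVar (v : WeylVar n 1) : dehom K n (var K (inclVar v)) = var K v := by
  rw [dehom_var]
  cases v with
  | x i => rfl
  | d i => rfl
  | h i =>
    rw [Subsingleton.elim i 0]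
    simp [inclVar, dehomVar]

theorem dehom_var_h_one : dehom K n (var K (h 1)) = 1 := by
  simp [dehom_var, dehomVar]

theorem dehom_normalMonomial (e : WeylVar n 2 →₀ ℕ) :
    dehom K n (normalMonomial K e) = normalMonomial K (forget e) := by
  simp [normalMonomial, map_list_prod, List.map_ofFn, Function.comp_def, dehom_var, dehomVar,
    forget_apply, inclVar]

/-- Normally ordered monomials go to normally ordered monomials, so dehomogenization merely adds up
coefficients along the fibres of `forget`. -/
theorem repr_dehom (P : DoubleHWeyl K n) :
    (normalBasis K n 1).repr (dehom K n P)
      = ((normalBasis K n 2).repr P).mapDomain forget := by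
  have : (normalBasis K n 1).repr.toLinearMap ∘ₗ (dehom K n).toLinearMap
      = Finsupp.lmapDomain K K forget ∘ₗ (normalBasis K n 2).repr.toLinearMap := by
    refine (normalBasis K n 2).ext fun e => ?_
    have h1 : dehom K n (normalBasis K n 2 e) = normalBasis K n 1 (forget e) := by
      rw [normalBasis_apply, normalBasis_apply, dehom_normalMonomial]
    simp only [LinearMap.comp_apply, AlgHom.toLinearMap_apply, LinearEquiv.coe_coe, h1,
      Module.Basis.repr_self, Finsupp.lmapDomain_apply, Finsupp.mapDomain_single]
  exact LinearMap.congr_fun this P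

/-- In one degree `forget` is injective, so no two terms of `P` merge and none cancel. -/
theorem IsHomogeneousOfDegree.mem_support_dehom {P : DoubleHWeyl K n} {N : ℕ}
    (hP : IsHomogeneousOfDegree P N) {f : WeylVar n 1 →₀ ℕ} :
    f ∈ support (dehom K n P) ↔ ∃ e ∈ support P, forget e = f := by
  classical
  rw [support, repr_dehom, Finsupp.mapDomain_support_of_injOn, Finset.mem_image]
  · rfl
  · intro a ha b hb hab
    exact eq_of_forget_eq_of_degree_eq hab ((hP a ha).trans (hP b hb).symm)

variable {lt : (WeylVar n 1 →₀ ℕ) → (WeylVar n 1 →₀ ℕ) → Prop}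

theorem IsLeadingExp.dehom {P : DoubleHWeyl K n} {N : ℕ} (hP : IsHomogeneousOfDegree P N)
    {e : WeylVar n 2 →₀ ℕ} (he : IsLeadingExp (blockOrder lt) P e) :
    IsLeadingExp lt (HomogWeyl.dehom K n P) (forget e) := by
  refine ⟨hP.mem_support_dehom.2 ⟨e, he.1, rfl⟩, fun f hf hne => ?_⟩
  obtain ⟨e', he', rfl⟩ := hP.mem_support_dehom.1 hf
  rcases he.2 e' he' (fun heq => hne (by rw [heq])) with h1 | h1
  · rw [hP e' he', hP e he.1] at h1
    exact absurd h1 (lt_irrefl _)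
  · exact h1.2

/-- `P` is nonzero and so has a leading exponent; its image is leading for the dehomogenization, and
leading exponents are unique. -/
theorem IsLocalOrder.exists_isLeadingExp_of_dehom (hlt : IsLocalOrder lt)
    {P : DoubleHWeyl K n} {N : ℕ} (hP : IsHomogeneousOfDegree P N)
    {f : WeylVar n 1 →₀ ℕ} (hf : IsLeadingExp lt (dehom K n P) f) :
    ∃ e, IsLeadingExp (blockOrder lt) P e ∧ forget e = f := by
  have := hlt.strictTotal
  have := hlt.blockOrder_strictTotal
  have hne : P ≠ 0 := by
    rintro rfl
    exact hf.ne_zero (map_zero _)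
  obtain ⟨e, he⟩ := exists_isLeadingExp (blockOrder lt) hne
  exact ⟨e, he, (he.dehom hP).unique hf⟩

end Dehom

/-! ### Homogeneous lifts and division by a Gröbner basis -/

section Ideals

variable {K : Type*} [Field K] {n : ℕ}

theorem dehom_mem_span_image {S : Set (DoubleHWeyl K n)} {P : DoubleHWeyl K n}
    (hP : P ∈ Ideal.span S) : dehom K n P ∈ Ideal.span (dehom K n '' S) := by
  induction hP using Submodule.span_induction with
  | mem y hy => exact Ideal.subset_span ⟨y, hy, rfl⟩
  | zero => simp
  | add y z _ _ hy hz => simpa using add_mem hy hz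
  | smul a y _ hy => simpa using Ideal.mul_mem_left _ _ hy

/-- Shows that `I` depends only on `J`, so that the given generators may be exchanged for
homogeneous ones. -/
theorem span_dehom_image_congr {S T : Set (DoubleHWeyl K n)}
    (hST : Ideal.span S = Ideal.span T) :
    Ideal.span (dehom K n '' S) = Ideal.span (dehom K n '' T) := by
  apply le_antisymm
  · rw [Ideal.span_le]
    rintro _ ⟨y, hy, rfl⟩
    exact dehom_mem_span_image (hST ▸ Ideal.subset_span hy)
  · rw [Ideal.span_le]
    rintro _ ⟨y, hy, rfl⟩
    exact dehom_mem_span_image (hST ▸ Ideal.subset_span hy)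

/-- Elements of `h_(0,1)(D)` that are dehomogenizations of homogeneous elements of `J`. -/
def HasHomogeneousLift (J : Ideal (DoubleHWeyl K n)) (P : HWeyl K n) : Prop :=
  ∃ Q ∈ J, ∃ N, IsHomogeneousOfDegree Q N ∧ dehom K n Q = P

theorem HasHomogeneousLift.add {J : Ideal (DoubleHWeyl K n)} {P Q : HWeyl K n}
    (hP : HasHomogeneousLift J P) (hQ : HasHomogeneousLift J Q) :
    HasHomogeneousLift J (P + Q) := by
  obtain ⟨P', hP, M, hM, rfl⟩ := hP
  obtain ⟨Q', hQ, N, hN, rfl⟩ := hQ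
  -- Crossed powers of `h'` bring both summands to degree `M + N` and become `1` under
  -- dehomogenization.
  refine ⟨var K (h 1) ^ N * P' + var K (h 1) ^ M * Q',
    add_mem (J.mul_mem_left _ hP) (J.mul_mem_left _ hQ), M + N, (hM.var_pow_mul _ N).add ?_, ?_⟩
  · rw [add_comm]
    exact hN.var_pow_mul _ M
  · simp [dehom_var_h_one]

/-- The multiplier need not be homogeneous: it is built from scalars and variables, each of which
lifts, and sums are handled by `HasHomogeneousLift.add`. -/
theorem HasHomogeneousLift.mul_left {J : Ideal (DoubleHWeyl K n)} {P : HWeyl K n}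
    (hP : HasHomogeneousLift J P) (a : HWeyl K n) : HasHomogeneousLift J (a * P) := by
  obtain ⟨p, rfl⟩ := RingQuot.mkAlgHom_surjective K (Rel K n 1) a
  induction p using FreeAlgebra.induction generalizing P with
  | grade0 c =>
    obtain ⟨Q, hQ, N, hN, rfl⟩ := hP
    refine ⟨c • Q, ?_, N, hN.smul c, ?_⟩
    · rw [Algebra.smul_def]
      exact J.mul_mem_left _ hQ
    · rw [map_smul, AlgHom.commutes, Algebra.smul_def]
  | grade1 v =>
    obtain ⟨Q, hQ, N, hN, rfl⟩ := hP
    refine ⟨var K (inclVar v) * Q, J.mul_mem_left _ hQ, N + 1, hN.var_mul _, ?_⟩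
    rw [map_mul, dehom_var_inclVar]
    rfl
  | mul a b ha hb =>
    rw [map_mul, mul_assoc]
    exact ha (hb hP)
  | add a b ha hb =>
    rw [map_add, add_mul]
    exact (ha hP).add (hb hP)

theorem IsHomogeneousIdeal.hasHomogeneousLift {F : Set (DoubleHWeyl K n)}
    (hF : IsHomogeneousIdeal (Ideal.span F)) {P : HWeyl K n}
    (hP : P ∈ Ideal.span (dehom K n '' F)) : HasHomogeneousLift (Ideal.span F) P := by
  obtain ⟨S, hS, hFS⟩ := hF
  rw [span_dehom_image_congr hFS] at hP
  induction hP using Submodule.span_induction with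
  | mem y hy =>
    obtain ⟨Q, hQ, rfl⟩ := hy
    obtain ⟨N, hN⟩ := hS Q hQ
    exact ⟨Q, hFS ▸ Ideal.subset_span hQ, N, hN, rfl⟩
  | zero => exact ⟨0, zero_mem _, 0, .zero 0, map_zero _⟩
  | add y z _ _ hy hz => exact hy.add hz
  | smul a y _ hy => exact hy.mul_left a

variable {lt : (WeylVar n 1 →₀ ℕ) → (WeylVar n 1 →₀ ℕ) → Prop}

/-- Cancelling the leading term of `P` against `Q` produces smaller leading exponents. -/
theorem IsLeadingExp.exists_sub_smul {n m : ℕ}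
    {lt : (WeylVar n m →₀ ℕ) → (WeylVar n m →₀ ℕ) → Prop}
    {P Q : HomogWeyl K n m} {e : WeylVar n m →₀ ℕ}
    (hP : IsLeadingExp lt P e) (hQ : IsLeadingExp lt Q e) :
    ∃ c : K, ∀ w ∈ support (P + c • Q), lt w e := by
  set b := normalBasis K n m
  have hq : b.repr Q e ≠ 0 := Finsupp.mem_support_iff.1 hQ.1
  refine ⟨-(b.repr P e / b.repr Q e), fun w hw => ?_⟩
  have hne : w ≠ e := by
    rintro rfl
    refine Finsupp.mem_support_iff.1 hw ?_
    change b.repr _ w = 0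
    rw [map_add, map_smul, Finsupp.add_apply, Finsupp.smul_apply, smul_eq_mul]
    field_simp
    ring
  rcases mem_support_add hw with h1 | h1
  · exact hP.2 w h1 hne
  · exact hQ.2 w (mem_support_smul h1) hne

/-- A homogeneous element of an ideal lies in the span of a homogeneous Gröbner basis. -/
theorem IsGroebnerBasis.mem_span_of_isHomogeneousOfDegree (hlt : IsLocalOrder lt)
    {J : Ideal (DoubleHWeyl K n)} {G : Set (DoubleHWeyl K n)}
    (hGhom : ∀ g ∈ G, IsHomogeneous g) (hG : IsGroebnerBasis (blockOrder lt) J G)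
    {P : DoubleHWeyl K n} (hPJ : P ∈ J) {N : ℕ} (hP : IsHomogeneousOfDegree P N) :
    P ∈ Ideal.span G := by
  have hst := hlt.blockOrder_strictTotal
  -- Termination of the division: a strict order on the finitely many exponents of degree `N` is
  -- well-founded.
  have hfin : Finite {e : WeylVar n 2 →₀ ℕ // e.degree = N} :=
    Set.Finite.subset (Finsupp.finite_of_degree_le N) 
      fun (e : WeylVar n 2 →₀ ℕ) (he : e.degree = N) => he.le
  let r : {e : WeylVar n 2 →₀ ℕ // e.degree = N} →
      {e : WeylVar n 2 →₀ ℕ // e.degree = N} → Prop := fun a b => blockOrder lt a b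
  have : IsTrans _ r := ⟨fun _ _ _ hab hbc => trans_of (blockOrder lt) hab hbc⟩
  have : Std.Irrefl r := ⟨fun _ ha => irrefl_of (blockOrder lt) _ ha⟩
  have hwf : WellFounded r := Finite.wellFounded_of_trans_of_irrefl r
  have key : ∀ e : {e : WeylVar n 2 →₀ ℕ // e.degree = N}, ∀ P ∈ J,
      IsHomogeneousOfDegree P N → IsLeadingExp (blockOrder lt) P e → P ∈ Ideal.span G := by
    intro e
    induction e using hwf.induction with
    | _ e ih =>
      intro P hPJ hP he
      obtain ⟨g, hg, a, c, ha, hac⟩ : e.1 ∈ leadingCone (blockOrder lt) G :=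
        hG.2.2.2 ▸ ⟨P, hPJ, he⟩
      obtain ⟨M, hM⟩ := hGhom g hg
      obtain ⟨Q, hQ, hQhom⟩ := ha.exists_mul hlt hM c
      rw [← hac] at hQ
      -- Since `a` has degree `M`, the multiple `Q * g` has degree `|a| + |c| = |e| = N`, so
      -- subtraction stays in degree `N`.
      rw [← hM a ha.1, ← map_add, ← hac, e.2] at hQhom
      have hQG : Q * g ∈ Ideal.span G := Ideal.mul_mem_left _ _ (Ideal.subset_span hg)
      have hQJ : Q * g ∈ J := Ideal.mul_mem_left _ _ (hG.2.2.1 hg)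
      obtain ⟨t, ht⟩ := he.exists_sub_smul hQ
      have hmem : P + t • (Q * g) ∈ Ideal.span G := by
        by_cases h0 : P + t • (Q * g) = 0
        · rw [h0]
          exact zero_mem _
        · obtain ⟨w, hw⟩ := exists_isLeadingExp (blockOrder lt) h0
          have hhom := hP.add (hQhom.smul t)
          refine ih ⟨w, hhom w hw.1⟩ (ht w hw.1) _ (add_mem hPJ ?_) hhom hw
          rw [Algebra.smul_def]
          exact J.mul_mem_left _ hQJ
      refine (Submodule.add_mem_iff_left _ ?_).1 hmem
      rw [Algebra.smul_def]
      exact Ideal.mul_mem_left _ _ hQG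
  by_cases h0 : P = 0
  · rw [h0]
    exact zero_mem _
  · obtain ⟨e, he⟩ := exists_isLeadingExp (blockOrder lt) h0
    exact key ⟨e, hP e he.1⟩ P hPJ hP he

end Ideals

end HomogWeyl

theorem mainTheorem13 {K : Type*} [Field K] (n : ℕ)
    (lt₁ : (WeylVar n 1 →₀ ℕ) → (WeylVar n 1 →₀ ℕ) → Prop)
    (hlt₁ : HomogWeyl.IsLocalOrder lt₁)
    (J : Ideal (DoubleHWeyl K n)) (hJ : HomogWeyl.IsHomogeneousIdeal J)
    (F : Set (DoubleHWeyl K n)) (hF : J = Ideal.span F)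
    (G : Set (DoubleHWeyl K n)) (hGhom : ∀ g ∈ G, HomogWeyl.IsHomogeneous g)
    (hG : HomogWeyl.IsGroebnerBasis (HomogWeyl.blockOrder lt₁) J G) :
    HomogWeyl.IsStandardBasis lt₁
      (Ideal.span (HomogWeyl.dehom K n '' F)) (HomogWeyl.dehom K n '' G) := by
  subst hF
  have hst := hlt₁.strictTotal
  have hst' := hlt₁.blockOrder_strictTotal
  refine ⟨hG.1.image _, ?_, le_antisymm ?_ ?_, Set.Subset.antisymm ?_ ?_⟩
  · rintro ⟨g, hg, hg0⟩
    obtain ⟨N, hN⟩ := hGhom g hg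
    obtain ⟨e, he⟩ := HomogWeyl.exists_isLeadingExp (HomogWeyl.blockOrder lt₁)
      (fun h0 => hG.2.1 (h0 ▸ hg) : g ≠ 0)
    exact (he.dehom hN).ne_zero hg0
  · rw [Ideal.span_le]
    rintro _ ⟨g, hg, rfl⟩
    exact HomogWeyl.dehom_mem_span_image (hG.2.2.1 hg)
  · intro P hP
    obtain ⟨Q, hQ, N, hN, rfl⟩ := hJ.hasHomogeneousLift hP
    exact HomogWeyl.dehom_mem_span_image
      (hG.mem_span_of_isHomogeneousOfDegree hlt₁ hGhom hQ hN)
  · rintro f ⟨P, hP, hf⟩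
    obtain ⟨Q, hQ, N, hN, rfl⟩ := hJ.hasHomogeneousLift hP
    obtain ⟨e, he, rfl⟩ := hlt₁.exists_isLeadingExp_of_dehom hN hf
    obtain ⟨g, hg, a, c, ha, rfl⟩ : e ∈ HomogWeyl.leadingCone (HomogWeyl.blockOrder lt₁) G :=
      hG.2.2.2 ▸ ⟨Q, hQ, he⟩
    obtain ⟨M, hM⟩ := hGhom g hg
    exact ⟨_, ⟨g, hg, rfl⟩, HomogWeyl.forget a, HomogWeyl.forget c, ha.dehom hM,
      HomogWeyl.forget_add a c⟩
  · rintro _ ⟨_, ⟨g, hg, rfl⟩, a, c, ha, rfl⟩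
    obtain ⟨M, hM⟩ := hGhom g hg
    obtain ⟨b, hb, rfl⟩ := hlt₁.exists_isLeadingExp_of_dehom hM ha
    -- Any lift of `c` will do, since its `h'`-part disappears again under `forget`.
    obtain ⟨c', rfl⟩ := HomogWeyl.exists_forget_eq c
    obtain ⟨Q, hQ, hQhom⟩ := hb.exists_mul hlt₁ hM c'
    rw [← HomogWeyl.forget_add]
    exact ⟨_, HomogWeyl.dehom_mem_span_image (Ideal.mul_mem_left _ Q (hG.2.2.1 hg)),
      hQ.dehom hQhom⟩
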